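/- A coloring of the vertices of a graph is nonrepetitive if there is no path $v_1,\dots,v_{2l}$ ($l\ge 1$) in the graph whose colors satisfy $c(v_i)=c(v_{l+i})$ for all $1\le i\le l$. Consider a finite or infinite process that begins with a graph $G_0$ and in each step $t\ge 1$ produces $G_t$ from $G_{t-1}$ by adding a new vertex $v_t$, a set $D_t$ of edges from $v_t$ to earlier vertices, and deleting a set $C_t\subseteq E(G_{t-1})$ of earlier edges. A strategy has to color the vertices of $G_0$ at the beginning and $v_t$ in step $t$, knowing only $G_0,\dots,G_t$; no vertex is ever recolored. It colors the process online nonrepetitively if, whatever the moves are, every $G_t$ is nonrepetitively colored. Using $16$ colors one can color online nonrepetitively (a) any tree: $G_0$ is a single vertex, at all times $G_{t-1}$ is a tree, and in each step either the new vertex is connected to one vertex, or it subdivides an edge $xy$ (it is connected to $x$ and $y$, and the edge $xy$ is deleted); (b) any cycle: $G_0$ is a triangle, at all times $G_{t-1}$ is a cycle, and in each step the new vertex subdivides an edge; (c) any series-parallel graph: $G_0$ is a single vertex, at all times $G_{t-1}$ is series-parallel (has no $K_4$ minor), and in each step the new vertex is connected to one vertex, or subdivides an edge, or is connected to two adjacent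 vertices, the edge between them being kept. -/

import Mathlib

namespace OnlineNonrep

/-! ### Nonrepetitive colorings -/

/-- A sequence `x₁ … x₂ₗ` with `l ≥ 1` is a repetition if `xᵢ = xₗ₊ᵢ` for `1 ≤ i ≤ l`. -/
def IsRepetition {K : Type*} (s : List K) : Prop :=
  ∃ x : List K, x ≠ [] ∧ s = x ++ x

/-- A vertex coloring is nonrepetitive if no path of the graph reads off a repetition. -/
def IsNonrepetitive {V K : Type*} (G : SimpleGraph V) (c : V → K) : Prop :=
  ∀ (u v : V) (p : G.Walk u v), p.IsPath → ¬ IsRepetition (p.support.map c)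

/-! ### The online process

The vertices are numbered in order of arrival. The starting graph has the `m` vertices
`0, …, m - 1`, and the graph `G t` after `t` steps has the `m + t` vertices `0, …, m + t - 1`. -/

/-- The graph obtained from `G` by deleting the edges in `C` and adding a new vertex
(the last one) joined exactly to the vertices in `D`. -/
def extend {n : ℕ} (G : SimpleGraph (Fin n)) (D : Set (Fin n)) (C : Set (Sym2 (Fin n))) :
    SimpleGraph (Fin (n + 1)) :=
  (G.deleteEdges C).map Fin.castSuccEmb ⊔
    SimpleGraph.fromEdgeSet ((fun x : Fin n => s(x.castSucc, Fin.last n)) '' D)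

/-- A restriction on the moves: which pairs `(D, C)` may be played on the current graph. -/
abbrev Rule : Type :=
  ∀ n : ℕ, SimpleGraph (Fin n) → Set (Fin n) → Set (Sym2 (Fin n)) → Prop

/-- A run of the process: the graph after each number `t` of steps. -/
abbrev Run (m : ℕ) : Type :=
  (t : ℕ) → SimpleGraph (Fin (m + t))

/-- `G` is, up to time `N` (where `N = ⊤` means forever), generated from `G₀` by moves that
follow the restriction `R`. -/
def IsGenerated {m : ℕ} (G₀ : SimpleGraph (Fin m)) (R : Rule) (N : ℕ∞) (G : Run m) : Prop :=
  G 0 = G₀ ∧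
  ∀ t : ℕ, ((t + 1 : ℕ) : ℕ∞) ≤ N →
    ∃ (D : Set (Fin (m + t))) (C : Set (Sym2 (Fin (m + t)))),
      C ⊆ (G t).edgeSet ∧ R (m + t) (G t) D C ∧ G (t + 1) = extend (G t) D C

/-- An online coloring strategy with colors in `K`. Vertex `i` arrives at time `i + 1 - m`
(which is `0` for the vertices of the starting graph); its color is chosen at that moment, so it
may depend only on the graphs seen up to then, and it is never changed afterwards. -/
structure Strategy (m : ℕ) (K : Type*) where
  /-- The color that vertex `i` receives in the run `G`. -/
  color : Run m → ℕ → K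
  /-- The color of vertex `i` does not depend on what happens after its arrival. -/
  nonanticipating : ∀ (G H : Run m) (i : ℕ), (∀ t ≤ i + 1 - m, G t = H t) → color G i = color H i

/-- With `k` colors one can color online nonrepetitively every graph that is generated from `G₀`
by moves that follow `R`: some strategy keeps the coloring nonrepetitive at all times, in all
finite and infinite runs. -/
def OnlineNonrepColorable {m : ℕ} (G₀ : SimpleGraph (Fin m)) (R : Rule) (k : ℕ) : Prop :=
  ∃ A : Strategy m (Fin k), ∀ (N : ℕ∞) (G : Run m), IsGenerated G₀ R N G →
    ∀ t : ℕ, (t : ℕ∞) ≤ N →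
      IsNonrepetitive (G t) (fun i : Fin (m + t) => A.color G i)

/-! ### The moves -/

/-- Connect the new vertex to one vertex. -/
def IsAttach {n : ℕ} (D : Set (Fin n)) (C : Set (Sym2 (Fin n))) : Prop :=
  ∃ x : Fin n, D = {x} ∧ C = ∅

/-- Subdivide an edge: connect the new vertex to two adjacent vertices and delete the edge
between them. -/
def IsSubdivide {n : ℕ} (G : SimpleGraph (Fin n)) (D : Set (Fin n)) (C : Set (Sym2 (Fin n))) :
    Prop :=
  ∃ x y : Fin n, G.Adj x y ∧ D = {x, y} ∧ C = {s(x, y)}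

/-- Connect the new vertex to two adjacent vertices, keeping the edge between them. -/
def IsAddEar {n : ℕ} (G : SimpleGraph (Fin n)) (D : Set (Fin n)) (C : Set (Sym2 (Fin n))) :
    Prop :=
  ∃ x y : Fin n, G.Adj x y ∧ D = {x, y} ∧ C = ∅

/-! ### The graph classes -/

/-- The graph is a cycle. -/
def IsCycleGraph {V : Type*} (G : SimpleGraph V) : Prop :=
  ∃ n : ℕ, 3 ≤ n ∧ Nonempty (G ≃g SimpleGraph.cycleGraph n)

/-- `K₄` is a minor of `G`: there are four pairwise disjoint vertex sets, each inducing a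
(nonempty) connected subgraph, with an edge of `G` between any two of them. -/
def HasK4Minor {V : Type*} (G : SimpleGraph V) : Prop :=
  ∃ B : Fin 4 → Set V,
    (∀ i, (G.induce (B i)).Connected) ∧
    (∀ i j, i ≠ j → Disjoint (B i) (B j)) ∧
    (∀ i j, i ≠ j → ∃ x ∈ B i, ∃ y ∈ B j, G.Adj x y)

/-- Series-parallel graphs, in the wide sense: graphs without a `K₄` minor. -/
def IsSeriesParallel {V : Type*} (G : SimpleGraph V) : Prop :=
  ¬ HasK4Minor G

/-- Online trees: the current graph is a tree, and the new vertex is connected to one vertex or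
subdivides an edge. -/
def treeRule : Rule := fun _ G D C =>
  G.IsTree ∧ (IsAttach D C ∨ IsSubdivide G D C)

/-- Online cycles: the current graph is a cycle, and the new vertex subdivides an edge. -/
def cycleRule : Rule := fun _ G D C =>
  IsCycleGraph G ∧ IsSubdivide G D C

/-- Online series-parallel graphs: the current graph is series-parallel, and the new vertex is
connected to one vertex, or subdivides an edge, or is connected to two adjacent vertices. -/
def seriesParallelRule : Rule := fun _ G D C =>
  IsSeriesParallel G ∧ (IsAttach D C ∨ IsSubdivide G D C ∨ IsAddEar G D C)

/-- The graph with a single vertex. -/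
def singleVertex : SimpleGraph (Fin 1) := ⊥

/-- The triangle. -/
def triangle : SimpleGraph (Fin 3) := ⊤

end OnlineNonrep

/-!
Edge deletions can be ignored: let `H` consist of all edges that are ever present. A new vertex is
always joined to a clique of at most two earlier vertices, and each edge of `H` is present when its
later end arrives. So it suffices to color `H` nonrepetitively in such a way that the color of a
vertex depends only on the edges of `H` among the vertices up to it. This works with `4 ^ k` colors if
cliques of at most `k` vertices are attached to (`IsCliqueAttached.map_backColor_ne`).

Give each vertex a `level`, one more than the lowest level of its earlier neighbours; it never
changes. Adjacent vertices have levels that differ by at most `1`, and inside a level each vertex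
is attached to a clique of at most `k - 1` vertices. The color consists of the term of the sequence
`letter` at the level, and recursively of a color in the graph of edges inside the levels.

The sequence `letter` on four symbols contains no squares and no palindromes, and comes from the
Thue–Morse sequence. A path is mapped by `level` to a lazy walk on `ℕ`, and if a lazy walk spells a
repetition of `letter`, then its two halves are equal (`lazyWalk_halves_eq`). So on a repetitively
colored path the vertices of lowest level have the same positions in both halves. They form a path
in their layer (`IsCliqueAttached.isChain_filter_level`), because the parts of the path above that
level can be short-cut one vertex at a time. This path is again colored repetitively, in the
recursive coloring. For `k = 0` there are no edges, hence no repetitively colored path.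
-/

namespace OnlineNonrep

/-! ### A square-free sequence on four letters without palindromes -/

/-- The Thue–Morse sequence: the parity of the number of binary digits `1` of `n`. -/
def thueMorse (n : ℕ) : Bool :=
  if n = 0 then false else (n % 2 == 1) ^^ thueMorse (n / 2)

theorem thueMorse_two_mul (n : ℕ) : thueMorse (2 * n) = thueMorse n := by
  rcases Nat.eq_zero_or_pos n with rfl | hn
  · rfl
  · rw [thueMorse, if_neg (by omega)]
    simp

theorem thueMorse_two_mul_add_one (n : ℕ) : thueMorse (2 * n + 1) = !thueMorse n := by
  rw [thueMorse, if_neg (by omega), show (2 * n + 1) % 2 = 1 by omega,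
    show (2 * n + 1) / 2 = n by omega]
  simp

theorem thueMorse_ne_succ_of_even {n : ℕ} (hn : n % 2 = 0) :
    thueMorse n ≠ thueMorse (n + 1) := by
  obtain ⟨m, rfl⟩ : ∃ m, n = 2 * m := ⟨n / 2, by omega⟩
  rw [thueMorse_two_mul, thueMorse_two_mul_add_one]
  simp

/-- The Thue–Morse sequence is overlap-free. An even period can be halved. An odd period `p`
forces the sequence to alternate over `p + 1` consecutive positions, since `j` or `j + p` is even;
then the two ends of this stretch differ. -/
theorem thueMorse_overlapFree (p : ℕ) (hp : 0 < p) (i : ℕ)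
    (h : ∀ k ≤ p, thueMorse (i + k) = thueMorse (i + k + p)) : False := by
  induction p using Nat.strong_induction_on generalizing i with
  | _ p ih =>
  rcases Nat.mod_two_eq_zero_or_one p with hp2 | hp2
  · obtain ⟨q, rfl⟩ : ∃ q, p = 2 * q := ⟨p / 2, by omega⟩
    refine ih q (by omega) (by omega) (i / 2) fun k hk => ?_
    have hk' := h (2 * k) (by omega)
    rcases Nat.mod_two_eq_zero_or_one i with hi | hi
    · rwa [show i + 2 * k = 2 * (i / 2 + k) by omega,
        show 2 * (i / 2 + k) + 2 * q = 2 * (i / 2 + k + q) by omega,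
        thueMorse_two_mul, thueMorse_two_mul] at hk'
    · rw [show i + 2 * k = 2 * (i / 2 + k) + 1 by omega,
        show 2 * (i / 2 + k) + 1 + 2 * q = 2 * (i / 2 + k + q) + 1 by omega,
        thueMorse_two_mul_add_one, thueMorse_two_mul_add_one] at hk'
      simpa using hk'
  · have alt : ∀ k < p, thueMorse (i + k + 1) = !thueMorse (i + k) := by
      intro k hk
      have hne : thueMorse (i + k) ≠ thueMorse (i + k + 1) := by
        rcases Nat.mod_two_eq_zero_or_one (i + k) with hi | hi
        · exact thueMorse_ne_succ_of_even hi
        · have h1 := h k (by omega)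
          have h2 := h (k + 1) (by omega)
          rw [h1, show i + k + 1 = i + (k + 1) by omega, h2,
            show i + (k + 1) + p = i + k + p + 1 by omega]
          exact thueMorse_ne_succ_of_even (by omega)
      revert hne
      cases thueMorse (i + k) <;> cases thueMorse (i + k + 1) <;> simp
    have par : ∀ k ≤ p, thueMorse (i + k) = (thueMorse i ^^ (k % 2 == 1)) := by
      intro k
      induction k with
      | zero => intro _; simp
      | succ k ihk =>
        intro hk
        rw [← add_assoc, alt k (by omega), ihk (by omega)]
        rcases Nat.mod_two_eq_zero_or_one k with h0 | h0
        · rw [h0, show (k + 1) % 2 = 1 by omega]; simp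
        · rw [h0, show (k + 1) % 2 = 0 by omega]; simp
    have h0 := h 0 (by omega)
    rw [add_zero, par p le_rfl, hp2] at h0
    simp at h0

/-- The difference of two consecutive terms of the Thue–Morse sequence, coded by `0, 1, 2`. -/
def thueDiff (n : ℕ) : Fin 4 :=
  if thueMorse n = thueMorse (n + 1) then 0 else if thueMorse n then 1 else 2

theorem thueDiff_ne_three (n : ℕ) : thueDiff n ≠ 3 := by
  unfold thueDiff
  split_ifs <;> decide

/-- The differences of the Thue–Morse sequence form a square-free sequence: over a square with
period `p`, the numbers `thueMorse (j + p) - thueMorse j` are constant. If they are zero, there is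
an overlap. Otherwise the differences vanish, and `thueMorse` is constant along the square. -/
theorem thueDiff_squareFree (i p : ℕ) (hp : 0 < p)
    (h : ∀ k < p, thueDiff (i + k) = thueDiff (i + k + p)) : False := by
  have key : ∀ x x' y y' : Bool,
      (if x = x' then 0 else if x then 1 else 2 : Fin 4) =
        (if y = y' then 0 else if y then 1 else 2) →
      (x = y → x' = y') ∧ (x ≠ y → x' = x ∧ x' ≠ y') := by decide
  have step : ∀ k < p, _ := fun k hk => key _ _ _ _ (h k hk)
  by_cases h0 : thueMorse i = thueMorse (i + p)
  · refine thueMorse_overlapFree p hp i fun k => ?_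
    induction k with
    | zero => intro _; exact h0
    | succ k ihk =>
      intro hk
      have := (step k (by omega)).1 (ihk (by omega))
      rwa [show i + k + p + 1 = i + (k + 1) + p by omega] at this
  · have hconst : ∀ k ≤ p, thueMorse (i + k) = thueMorse i ∧
        thueMorse (i + k) ≠ thueMorse (i + k + p) := by
      intro k
      induction k with
      | zero => intro _; exact ⟨rfl, h0⟩
      | succ k ihk =>
        intro hk
        obtain ⟨h1, h2⟩ := ihk (by omega)
        obtain ⟨h3, h4⟩ := (step k (by omega)).2 h2
        rw [show i + k + p + 1 = i + (k + 1) + p by omega] at h4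
        exact ⟨h3.trans h1, h4⟩
    exact h0 (hconst p le_rfl).1.symm

/-- The sequence `thueDiff` with the letter `3` inserted after every second letter. -/
def letter (n : ℕ) : Fin 4 :=
  if n % 3 = 2 then 3 else thueDiff (2 * (n / 3) + n % 3)

theorem letter_eq_three_iff (n : ℕ) : letter n = 3 ↔ n % 3 = 2 := by
  unfold letter
  split_ifs with h
  · simp [h]
  · simp [h, thueDiff_ne_three]

theorem thueDiff_ne_succ (n : ℕ) : thueDiff n ≠ thueDiff (n + 1) := fun h =>
  thueDiff_squareFree n 1 one_pos fun k hk => by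
    obtain rfl : k = 0 := by omega
    exact h

theorem letter_ne_succ (n : ℕ) : letter n ≠ letter (n + 1) := by
  intro h
  by_cases h1 : n % 3 = 2
  · rw [(letter_eq_three_iff n).2 h1, eq_comm, letter_eq_three_iff] at h
    omega
  by_cases h2 : (n + 1) % 3 = 2
  · rw [(letter_eq_three_iff (n + 1)).2 h2, letter_eq_three_iff] at h
    omega
  rw [letter, if_neg h1, letter, if_neg h2,
    show 2 * ((n + 1) / 3) + (n + 1) % 3 = 2 * (n / 3) + n % 3 + 1 by omega] at h
  exact thueDiff_ne_succ _ h

/-- Together with square-freeness, this excludes palindromes of every length above `1`: a longer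
palindrome has one of length `2` or `3` in its middle. -/
theorem letter_ne_add_two (n : ℕ) : letter n ≠ letter (n + 2) := by
  intro h
  by_cases h1 : n % 3 = 2
  · rw [(letter_eq_three_iff n).2 h1, eq_comm, letter_eq_three_iff] at h
    omega
  by_cases h2 : (n + 2) % 3 = 2
  · rw [(letter_eq_three_iff (n + 2)).2 h2, letter_eq_three_iff] at h
    omega
  rw [letter, if_neg h1, letter, if_neg h2,
    show 2 * ((n + 2) / 3) + (n + 2) % 3 = 2 * (n / 3) + n % 3 + 1 by omega] at h
  exact thueDiff_ne_succ _ h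

theorem letter_squareFree (i p : ℕ) (hp : 0 < p)
    (h : ∀ j, i ≤ j → j < i + p → letter j = letter (j + p)) : False := by
  by_cases h1 : p = 1
  · subst h1
    exact letter_ne_succ i (h i le_rfl (by omega))
  by_cases h2 : p = 2
  · subst h2
    exact letter_ne_add_two i (h i le_rfl (by omega))
  -- A square this long has the inserted letter in its first half, so `3` divides the period.
  have h3 : p % 3 = 0 := by
    have := h (i + (2 - i % 3)) (by omega) (by omega)
    rw [(letter_eq_three_iff _).2 (by omega), eq_comm, letter_eq_three_iff] at this
    omega
  obtain ⟨q, rfl⟩ : ∃ q, p = 3 * q := ⟨p / 3, by omega⟩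
  -- Position `a` of `thueDiff` moves to position `3 * (a / 2) + a % 2`.
  have hl : ∀ a, letter (3 * (a / 2) + a % 2) = thueDiff a := by
    intro a
    rw [letter, if_neg (by omega)]
    congr 1
    omega
  refine thueDiff_squareFree ((2 * i + 2) / 3) (2 * q) (by omega) fun k hk => ?_
  set a := (2 * i + 2) / 3 + k with ha
  rw [← hl a, ← hl (a + 2 * q), h _ (by omega) (by omega)]
  congr 1
  omega

/-! ### Lazy walks along the sequence -/

/-- Two natural numbers are close if they differ by at most `1`. -/
def Close (a b : ℕ) : Prop := a ≤ b + 1 ∧ b ≤ a + 1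

theorem eq_of_close_of_letter_eq {a b : ℕ} (h : Close a b) (hl : letter a = letter b) :
    a = b := by
  obtain ⟨h1, h2⟩ := h
  by_contra hne
  rcases (by omega : b = a + 1 ∨ a = b + 1) with rfl | rfl
  · exact letter_ne_succ _ hl
  · exact letter_ne_succ _ hl.symm

theorem eq_of_le_add_two_of_letter_eq {a b : ℕ} (h1 : a ≤ b + 2) (h2 : b ≤ a + 2)
    (hl : letter a = letter b) : a = b := by
  by_contra hne
  rcases (by omega : b = a + 1 ∨ a = b + 1 ∨ b = a + 2 ∨ a = b + 2) with rfl | rfl | rfl | rfl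
  · exact letter_ne_succ _ hl
  · exact letter_ne_succ _ hl.symm
  · exact letter_ne_add_two _ hl
  · exact letter_ne_add_two _ hl.symm

/-- A discrete intermediate value theorem. -/
theorem exists_eq_of_close {f : ℕ → ℕ} {n : ℕ} (hf : ∀ i < n, Close (f i) (f (i + 1))) {j : ℕ}
    (hj : f 0 ≤ j ∧ j ≤ f n ∨ f n ≤ j ∧ j ≤ f 0) : ∃ i ≤ n, f i = j := by
  induction n with
  | zero => exact ⟨0, le_rfl, by omega⟩
  | succ n ih =>
    obtain ⟨h1, h2⟩ := hf n (by omega)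
    by_cases hlast : f (n + 1) = j
    · exact ⟨n + 1, le_rfl, hlast⟩
    · obtain ⟨i, hi, hij⟩ := ih (fun i hi => hf i (by omega)) (by omega)
      exact ⟨i, by omega, hij⟩

/-- If the two halves of a lazy walk spell the same word, then the second half is obtained from
the first one by a translation or by a reflection, because the word shows where the walk rests and
where it turns. In the second case, the first half is not at rest all the time. -/
theorem translation_or_reflection {f : ℕ → ℕ} {l : ℕ}
    (hf : ∀ i, i + 1 < 2 * l → Close (f i) (f (i + 1)))
    (hl : ∀ i < l, letter (f i) = letter (f (i + l))) (n : ℕ) (hn : n < l) :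
    (∀ i ≤ n, f (i + l) + f 0 = f i + f l) ∨
      ((∀ i ≤ n, f (i + l) + f i = f 0 + f l) ∧ ∃ i ≤ n, Close (f i) (f n) ∧ f i ≠ f n) := by
  -- The induction also needs the neighbour of the current place in the case of a translation.
  suffices H : ((∀ i ≤ n, f i = f 0) ∧ ∀ i ≤ n, f (i + l) = f l) ∨
      (((∀ i ≤ n, f (i + l) + f 0 = f i + f l) ∨ ∀ i ≤ n, f (i + l) + f i = f 0 + f l) ∧
        ∃ i ≤ n, Close (f i) (f n) ∧ f i ≠ f n) by
    rcases H with ⟨h1, h2⟩ | ⟨h1 | h1, h2⟩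
    · exact Or.inl fun i hi => by rw [h1 i hi, h2 i hi, add_comm]
    · exact Or.inl h1
    · exact Or.inr ⟨h1, h2⟩
  induction n with
  | zero =>
    refine Or.inl ⟨fun i hi => ?_, fun i hi => ?_⟩ <;> obtain rfl : i = 0 := by omega
    · rfl
    · rw [zero_add]
  | succ n ih =>
    have c1 := hf n (by omega)
    have c2 := hf (n + l) (by omega)
    rw [show n + l + 1 = n + 1 + l by omega] at c2
    have l0 := hl n (by omega)
    have l1 := hl (n + 1) hn
    have rest : f n = f (n + 1) ↔ f (n + l) = f (n + 1 + l) :=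
      ⟨fun h => eq_of_close_of_letter_eq c2 (by rw [← l0, ← l1, h]),
        fun h => eq_of_close_of_letter_eq c1 (by rw [l0, l1, h])⟩
    rcases ih (by omega) with ⟨h1, h2⟩ | ⟨h1, i, hi, ci, nei⟩
    · have e1 := h1 n le_rfl
      have e2 := h2 n le_rfl
      by_cases hr : f n = f (n + 1)
      · have hr' := rest.1 hr
        refine Or.inl ⟨fun i hi => ?_, fun i hi => ?_⟩ <;>
          rcases Nat.le_add_one_iff.1 hi with hi | rfl
        · exact h1 i hi
        · omega
        · exact h2 i hi
        · exact hr'.symm.trans e2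
      · have hr' := mt rest.2 hr
        refine Or.inr ⟨?_, n, by omega, c1, hr⟩
        obtain ⟨c11, c12⟩ := c1
        obtain ⟨c21, c22⟩ := c2
        have hcase : f (n + 1 + l) + f 0 = f (n + 1) + f l ∨
            f (n + 1 + l) + f (n + 1) = f 0 + f l := by omega
        refine hcase.imp (fun h i hi => ?_) (fun h i hi => ?_) <;>
          rcases Nat.le_add_one_iff.1 hi with hi | rfl
        · rw [h1 i hi, h2 i hi, add_comm]
        · exact h
        · rw [h1 i hi, h2 i hi, add_comm]
        · exact h
    · have li := hl i (by omega)
      obtain ⟨c11, c12⟩ := c1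
      obtain ⟨c21, c22⟩ := c2
      obtain ⟨ci1, ci2⟩ := ci
      have turn : f i = f (n + 1) ↔ f (i + l) = f (n + 1 + l) := by
        refine ⟨fun h => ?_, fun h => ?_⟩
        · refine eq_of_le_add_two_of_letter_eq ?_ ?_ (by rw [← li, ← l1, h]) <;>
            rcases h1 with h1 | h1 <;> have := h1 i hi <;> have := h1 n le_rfl <;> omega
        · exact eq_of_le_add_two_of_letter_eq (by omega) (by omega) (by rw [li, l1, h])
      refine Or.inr ⟨?_, ?_⟩
      · refine h1.imp (fun h1 j hj => ?_) (fun h1 j hj => ?_) <;>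
          rcases Nat.le_add_one_iff.1 hj with hj | rfl
        · exact h1 j hj
        · have := h1 i hi
          have := h1 n le_rfl
          omega
        · exact h1 j hj
        · have := h1 i hi
          have := h1 n le_rfl
          omega
      · by_cases hr : f n = f (n + 1)
        · exact ⟨i, by omega, hr ▸ ⟨ci1, ci2⟩, hr ▸ nei⟩
        · exact ⟨n, by omega, ⟨c11, c12⟩, hr⟩

/-- If the two halves of a lazy walk spell the same word, then they are equal. A proper
translation would give a square of `letter`, a reflection a palindrome. -/
theorem lazyWalk_halves_eq {f : ℕ → ℕ} {l : ℕ}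
    (hf : ∀ i, i + 1 < 2 * l → Close (f i) (f (i + 1)))
    (hl : ∀ i < l, letter (f i) = letter (f (i + l))) (n : ℕ) (hn : n < l) :
    f n = f (n + l) := by
  obtain ⟨d, rfl⟩ : ∃ d, l = d + 1 := ⟨l - 1, by omega⟩
  obtain ⟨j1, j2⟩ := hf d (by omega)
  have ivt : ∀ j, (f 0 ≤ j ∧ j ≤ f d ∨ f d ≤ j ∧ j ≤ f 0) → ∃ i ≤ d, f i = j := fun j hj =>
    exists_eq_of_close (fun i hi => hf i (by omega)) hj
  rcases translation_or_reflection hf hl d (by omega) with h | ⟨h, i, hi, ⟨ci1, ci2⟩, nei⟩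
  · rcases lt_trichotomy (f 0) (f (d + 1)) with h0 | h0 | h0
    · refine (letter_squareFree (f 0) (f (d + 1) - f 0) (by omega) fun j hj1 hj2 => ?_).elim
      obtain ⟨i, hi, rfl⟩ := ivt j (by omega)
      rw [hl i (by omega)]
      congr 1
      have := h i hi
      omega
    · have := h n (by omega)
      omega
    · have hd := h d le_rfl
      refine (letter_squareFree (2 * f (d + 1) + 1 - f 0) (f 0 - f (d + 1)) (by omega)
        fun j hj1 hj2 => ?_).elim
      obtain ⟨i, hi, hij⟩ := ivt (j + (f 0 - f (d + 1))) (by omega)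
      rw [← hij, hl i (by omega)]
      congr 1
      have := h i hi
      omega
  · exfalso
    have refl : ∀ j, (∃ i ≤ d, f i = j) → letter j = letter (f 0 + f (d + 1) - j) := by
      rintro j ⟨i, hi, rfl⟩
      rw [hl i (by omega)]
      congr 1
      have := h i hi
      omega
    have hi' := h i hi
    have hd := h d le_rfl
    -- The centre of the reflection is within `1 / 2` of the values of the first half.
    obtain ⟨c, hc | hc⟩ : ∃ c, f 0 + f (d + 1) = 2 * c ∨ f 0 + f (d + 1) = 2 * c + 1 :=
      ⟨(f 0 + f (d + 1)) / 2, by omega⟩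
    · have key : (∃ i ≤ d, f i = c + 1) ∨ (∃ i ≤ d, f i + 1 = c) := by
        by_cases h0d : f 0 = f d
        · rcases (by omega : f i = c + 1 ∨ f i + 1 = c) with h' | h'
          · exact Or.inl ⟨i, hi, h'⟩
          · exact Or.inr ⟨i, hi, h'⟩
        · by_cases hup : f 0 ≤ c + 1 ∧ c + 1 ≤ f d ∨ f d ≤ c + 1 ∧ c + 1 ≤ f 0
          · exact Or.inl (ivt _ hup)
          · obtain ⟨i, hi, h'⟩ := ivt (c - 1) (by omega)
            exact Or.inr ⟨i, hi, by omega⟩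
      rcases key with ⟨i, hi, h'⟩ | ⟨i, hi, h'⟩
      · have e := refl (f i) ⟨i, hi, rfl⟩
        have := h i hi
        have := eq_of_le_add_two_of_letter_eq (by omega) (by omega) e
        omega
      · have e := refl (f i) ⟨i, hi, rfl⟩
        have := h i hi
        have := eq_of_le_add_two_of_letter_eq (by omega) (by omega) e
        omega
    · have key : (∃ i ≤ d, f i = c) ∨ ∃ i ≤ d, f i = c + 1 := by
        by_cases hup : f 0 ≤ c ∧ c ≤ f d ∨ f d ≤ c ∧ c ≤ f 0
        · exact Or.inl (ivt _ hup)
        · exact Or.inr (ivt _ (by omega))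
      rcases key with ⟨i, hi, h'⟩ | ⟨i, hi, h'⟩
      · have e := refl (f i) ⟨i, hi, rfl⟩
        have := eq_of_le_add_two_of_letter_eq (by omega) (by omega) e
        omega
      · have e := refl (f i) ⟨i, hi, rfl⟩
        have := eq_of_le_add_two_of_letter_eq (by omega) (by omega) e
        omega

theorem eq_of_map_letter_eq {a b : List ℕ} (hc : (a ++ b).IsChain Close)
    (h : a.map letter = b.map letter) : a = b := by
  have hlen : a.length = b.length := by simpa using congrArg List.length h
  have hfa : ∀ i (hi : i < a.length), (a ++ b).getD i 0 = a[i] := fun i hi => by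
    rw [List.getD_append _ _ _ _ hi, List.getD_eq_getElem]
  have hfb : ∀ i (hi : i < a.length), (a ++ b).getD (i + a.length) 0 = b[i] := fun i hi => by
    rw [List.getD_append_right _ _ _ _ (by omega), List.getD_eq_getElem _ _ (by omega)]
    congr 1
    omega
  refine List.ext_getElem hlen fun i hi _ => ?_
  rw [← hfa i hi, ← hfb i hi]
  refine lazyWalk_halves_eq (f := fun i => (a ++ b).getD i 0) (fun j hj => ?_) (fun j hj => ?_)
    i hi
  · have hj' : j + 1 < (a ++ b).length := by rw [List.length_append]; omega
    rw [List.getD_eq_getElem _ _ hj', List.getD_eq_getElem _ _ (by omega)]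
    exact hc.getElem j hj'
  · rw [hfa j hj, hfb j hj]
    have := List.getElem_of_eq h (i := j) (by simpa using hj)
    simpa using this

/-! ### Graphs built by attaching vertices to cliques -/

/-- A graph on `ℕ` given by the set `B v` of earlier neighbours of each vertex `v`, in which `B v`
is always a clique of at most `k` vertices. Isolated vertices may serve as fillers, so finite
graphs are covered as well. -/
structure IsCliqueAttached (B : ℕ → Set ℕ) (k : ℕ) : Prop where
  lt : ∀ v, ∀ u ∈ B v, u < v
  clique : ∀ v, ∀ u ∈ B v, ∀ u' ∈ B v, u = u' ∨ u ∈ B u' ∨ u' ∈ B u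
  encard_le : ∀ v, (B v).encard ≤ k

/-- Adjacency in the graph with the sets `B v` of earlier neighbours. -/
def BackAdj (B : ℕ → Set ℕ) (u v : ℕ) : Prop := u ∈ B v ∨ v ∈ B u

/-- The level of a vertex: `0` if it has no earlier neighbour, otherwise one more than the lowest
level of an earlier neighbour. The first case is the value `sInf ∅ = 0`; the condition `u < v` is
only there to make the recursion well-founded. -/
noncomputable def level (B : ℕ → Set ℕ) (v : ℕ) : ℕ :=
  sInf (Set.range fun u : {u // u ∈ B v ∧ u < v} => level B u + 1)
termination_by v
decreasing_by exact u.2.2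

/-- The graph of the edges that join vertices of the same level, again given by the sets of earlier
neighbours. -/
def layer (B : ℕ → Set ℕ) (v : ℕ) : Set ℕ := {u ∈ B v | level B u = level B v}

/-- The coloring with `4 ^ k` colors: the letter of the level, followed by the coloring of the
graph of the edges inside the layers, in which the cliques are smaller. -/
noncomputable def backColor : (k : ℕ) → (ℕ → Set ℕ) → ℕ → Fin k → Fin 4
  | 0, _, _ => Fin.elim0
  | k + 1, B, v => Fin.cons (letter (level B v)) (backColor k (layer B) v)

theorem level_congr {B B' : ℕ → Set ℕ} {v : ℕ} (h : ∀ u ≤ v, B u = B' u) :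
    level B v = level B' v := by
  induction v using Nat.strong_induction_on with
  | _ v ih =>
  have hset : (Set.range fun u : {u // u ∈ B v ∧ u < v} => level B u + 1) =
      Set.range fun u : {u // u ∈ B' v ∧ u < v} => level B' u + 1 := by
    ext x
    simp only [Set.mem_range, Subtype.exists, h v le_rfl]
    refine exists_congr fun u => exists_congr fun hu => ?_
    rw [ih u hu.2 fun w hw => h w (hw.trans hu.2.le)]
  rw [level, level, hset]

/-- The color of a vertex depends only on the earlier neighbours of the vertices up to it. -/
theorem backColor_congr {k : ℕ} {B B' : ℕ → Set ℕ} {v : ℕ} (hB : ∀ w, ∀ u ∈ B w, u < w)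
    (h : ∀ u ≤ v, B u = B' u) : backColor k B v = backColor k B' v := by
  induction k generalizing B B' with
  | zero => rfl
  | succ k ih =>
    rw [backColor, backColor, level_congr h, ih (fun w u hu => hB w u hu.1) fun u hu => ?_]
    ext x
    simp only [layer, ← h u hu, Set.mem_ofPred_eq]
    refine and_congr_right fun hx => ?_
    rw [level_congr fun w hw => h w (hw.trans hu),
      level_congr fun w hw => h w (hw.trans ((hB u x hx).le.trans hu))]

namespace IsCliqueAttached

variable {B : ℕ → Set ℕ} {k : ℕ}

theorem level_le (hB : IsCliqueAttached B k) {u v : ℕ} (h : u ∈ B v) :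
    level B v ≤ level B u + 1 := by
  rw [level]
  exact Nat.sInf_le ⟨⟨u, h, hB.lt v u h⟩, rfl⟩

theorem exists_level_eq (hB : IsCliqueAttached B k) {v : ℕ} (h : (B v).Nonempty) :
    ∃ u ∈ B v, level B v = level B u + 1 := by
  obtain ⟨u, hu⟩ := h
  have hne : (Set.range fun u : {u // u ∈ B v ∧ u < v} => level B u + 1).Nonempty :=
    ⟨_, ⟨u, hu, hB.lt v u hu⟩, rfl⟩
  obtain ⟨w, hw⟩ := Nat.sInf_mem hne
  exact ⟨w, w.2.1, by rw [level, ← hw]⟩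

/-- Levels do not decrease along an edge from an earlier to a later vertex. -/
theorem le_level (hB : IsCliqueAttached B k) {u v : ℕ} (h : u ∈ B v) :
    level B u ≤ level B v := by
  -- For the neighbour `y` of lowest level, induction is needed if `y` is later than `u`.
  induction v using Nat.strong_induction_on generalizing u with
  | _ v ih =>
  obtain ⟨y, hy, hvy⟩ := hB.exists_level_eq ⟨u, h⟩
  rcases hB.clique v u h y hy with rfl | huy | hyu
  · omega
  · have := ih y (hB.lt v y hy) huy
    omega
  · have := hB.level_le hyu
    omega

theorem close_level (hB : IsCliqueAttached B k) {u v : ℕ} (h : BackAdj B u v) :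
    Close (level B u) (level B v) := by
  rcases h with h | h
  · exact ⟨(hB.le_level h).trans (Nat.le_succ _), hB.level_le h⟩
  · exact ⟨hB.level_le h, (hB.le_level h).trans (Nat.le_succ _)⟩

/-- Passing to the layers lowers the size of the cliques, because the neighbour of lowest level is
lost. -/
theorem isCliqueAttached_layer (hB : IsCliqueAttached B (k + 1)) :
    IsCliqueAttached (layer B) k where
  lt v u hu := hB.lt v u hu.1
  clique v u hu u' hu' := by
    have e := hu.2.trans hu'.2.symm
    exact (hB.clique v u hu.1 u' hu'.1).imp id (Or.imp (⟨·, e⟩) (⟨·, e.symm⟩))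
  encard_le v := by
    rcases (B v).eq_empty_or_nonempty with h0 | hne
    · simp [layer, h0]
    · obtain ⟨y, hy, hvy⟩ := hB.exists_level_eq hne
      have hsub : insert y (layer B v) ⊆ B v :=
        Set.insert_subset hy fun u hu => hu.1
      have hle := (Set.encard_le_encard hsub).trans (hB.encard_le v)
      rw [Set.encard_insert_of_notMem fun h => by have := h.2; omega] at hle
      push_cast at hle
      exact (ENat.add_le_add_iff_right ENat.one_ne_top).1 hle

/-- If a walk stays in the levels `≥ r`, its vertices of level `r` form a walk, up to
stationary steps: the latest vertex of higher level can be left out, since its neighbours on the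
walk are both earlier neighbours of it and hence adjacent. -/
theorem isChain_filter_level (hB : IsCliqueAttached B k) (r : ℕ) (s : List ℕ)
    (hr : ∀ v ∈ s, r ≤ level B v) (hs : s.IsChain fun u v => u = v ∨ BackAdj B u v) :
    (s.filter (level B · = r)).IsChain fun u v => u = v ∨ BackAdj B u v := by
  induction hn : s.length generalizing s with
  | zero => simp [List.length_eq_zero_iff.1 hn]
  | succ n ih =>
  by_cases hex : ∃ v ∈ s, level B v ≠ r
  · obtain ⟨z, hz, hmax⟩ := (s.toFinset.filter (level B · ≠ r)).exists_max_image id (by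
      obtain ⟨v, hv, hvr⟩ := hex
      exact ⟨v, by simp [hv, hvr]⟩)
    simp only [Finset.mem_filter, List.mem_toFinset, id] at hz hmax
    have early : ∀ v ∈ s, v = z ∨ BackAdj B v z → v = z ∨ v ∈ B z := by
      rintro v hv (h | h | h)
      · exact Or.inl h
      · exact Or.inr h
      · exfalso
        have h1 := hB.lt v z h
        have h2 := hB.le_level h
        have h3 := hr z hz.1
        have h4 : level B v ≠ r := by have := hz.2; omega
        have := hmax v ⟨hv, h4⟩
        omega
    obtain ⟨p, q, rfl⟩ := List.append_of_mem hz.1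
    have hfilter : (p ++ z :: q).filter (level B · = r) = (p ++ q).filter (level B · = r) := by
      simp [List.filter_append, hz.2]
    rw [hfilter]
    refine ih (p ++ q) (fun v hv => hr v ?_) ?_ (by simp at hn ⊢; omega)
    · simp only [List.mem_append, List.mem_cons] at hv ⊢
      tauto
    · rw [List.isChain_append, List.isChain_cons] at hs
      obtain ⟨hp, ⟨hzq, hq⟩, hpz⟩ := hs
      refine List.isChain_append.2 ⟨hp, hq, fun a ha b hb => ?_⟩
      have haz := hpz a ha z (by simp)
      have hzb := hzq b hb
      have hb' : b = z ∨ BackAdj B b z := hzb.imp Eq.symm Or.symm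
      have has : a ∈ p ++ z :: q := by simp [List.mem_of_mem_getLast? ha]
      have hbs : b ∈ p ++ z :: q := by simp [List.mem_of_mem_head? hb]
      rcases early a has haz with rfl | ha'
      · exact hzb
      · rcases early b hbs hb' with rfl | hb'
        · exact haz
        · exact hB.clique z a ha' b hb'
  · push Not at hex
    rwa [List.filter_eq_self.2 (by simpa using hex)]

end IsCliqueAttached

theorem map_prodMk_eq {α β γ : Type*} {f : α → β} {g : α → γ} {s s' : List α}
    (hf : s.map f = s'.map f) (hg : s.map g = s'.map g) :
    (s.map fun a => (f a, g a)) = s'.map fun a => (f a, g a) := by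
  induction s generalizing s' with
  | nil => simp_all
  | cons a s ih =>
    cases s' with
    | nil => simp at hf
    | cons a' s' =>
      simp only [List.map_cons, List.cons.injEq, Prod.mk.injEq] at hf hg ⊢
      exact ⟨⟨hf.1, hg.1⟩, ih hf.2 hg.2⟩

/-- No path is colored repetitively. The levels along a repetitively colored path are repeated
too, so its vertices of lowest level form a repetitively colored path in a layer. -/
theorem IsCliqueAttached.map_backColor_ne {k : ℕ} {B : ℕ → Set ℕ} (hB : IsCliqueAttached B k)
    {s s' : List ℕ} (hs : s ≠ []) (hnd : (s ++ s').Nodup) (hc : (s ++ s').IsChain (BackAdj B)) :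
    s.map (backColor k B) ≠ s'.map (backColor k B) := by
  intro h
  induction k generalizing B s s' with
  | zero =>
    have hB0 : ∀ v, B v = ∅ := fun v => by simpa using hB.encard_le v
    have hlen : s.length = s'.length := by simpa using congrArg List.length h
    match s, s', hs with
    | a :: s, a' :: s', _ =>
      have hhead := (List.isChain_cons.1 hc).1
      obtain ⟨b, hb⟩ : ∃ b, b ∈ (s ++ a' :: s').head? := by cases s <;> simp
      simpa [BackAdj, hB0] using hhead b hb
  | succ k ih =>
    have hlevel : s.map (level B) = s'.map (level B) := by
      refine eq_of_map_letter_eq ?_ ?_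
      · rw [← List.map_append, List.isChain_map]
        exact hc.imp fun u v => hB.close_level
      · have := congrArg (List.map fun c => c 0) h
        simpa [Function.comp_def, backColor] using this
    have hcolor : s.map (backColor k (layer B)) = s'.map (backColor k (layer B)) := by
      have := congrArg (List.map Fin.tail) h
      simpa [Function.comp_def, backColor] using this
    obtain ⟨z, hz, hmin⟩ := s.toFinset.exists_min_image (level B)
      (List.toFinset_nonempty_iff s |>.2 hs)
    rw [List.mem_toFinset] at hz
    have hmin' : ∀ v ∈ s ++ s', level B z ≤ level B v := by
      intro v hv
      rcases List.mem_append.1 hv with hv | hv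
      · exact hmin v (List.mem_toFinset.2 hv)
      · obtain ⟨u, hu, huv⟩ := List.mem_map.1 (hlevel ▸ List.mem_map_of_mem hv)
        exact huv ▸ hmin u (List.mem_toFinset.2 hu)
    have hnd' := hnd.filter (level B · = level B z)
    have hchain := hB.isChain_filter_level (level B z) (s ++ s') hmin' (hc.imp fun _ _ => Or.inr)
    have hchain' : ((s ++ s').filter (level B · = level B z)).IsChain (BackAdj (layer B)) := by
      refine List.isChain_iff_getElem.2 fun i hi => ?_
      rcases hchain.getElem i hi with huv | huv
      · have := hnd'.getElem_inj_iff.1 huv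
        omega
      · have hu := (List.mem_filter.1 (List.getElem_mem (Nat.lt_of_succ_lt hi))).2
        have hv := (List.mem_filter.1 (List.getElem_mem hi)).2
        have e := (of_decide_eq_true hu).trans (of_decide_eq_true hv).symm
        exact huv.imp (⟨·, e⟩) (⟨·, e.symm⟩)
    rw [List.filter_append] at hnd' hchain'
    refine ih hB.isCliqueAttached_layer ?_ hnd' hchain' ?_
    · exact List.ne_nil_of_mem (List.mem_filter.2 ⟨hz, by simp⟩)
    · have h2 := congrArg (fun l => (l.filter fun x => x.1 = level B z).map Prod.snd)
        (map_prodMk_eq hlevel hcolor)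
      simpa [List.filter_map, Function.comp_def] using h2

/-! ### The strategy -/

section Strategy

variable {m : ℕ}

/-- Adjacency of the vertices with numbers `a` and `b` in the graph after `t` steps. -/
def RunAdj (G : Run m) (t a b : ℕ) : Prop :=
  ∃ (ha : a < m + t) (hb : b < m + t), (G t).Adj ⟨a, ha⟩ ⟨b, hb⟩

/-- The earlier neighbours of vertex `i` at the time of its arrival. -/
def backSet (G : Run m) (i : ℕ) : Set ℕ := {j | j < i ∧ RunAdj G (i + 1 - m) j i}

theorem mem_backSet {G : Run m} {t i j : ℕ} (ht : i + 1 - m = t) :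
    j ∈ backSet G i ↔ j < i ∧ RunAdj G t j i := by
  subst ht
  rfl

/-- The strategy that forgets the deletions of edges and colors each vertex by `backColor`. -/
noncomputable def backStrategy (m k : ℕ) : Strategy m (Fin k → Fin 4) where
  color G i := backColor k (backSet G) i
  nonanticipating G H i h := backColor_congr (fun _ _ hu => hu.1) fun u hu => by
    ext j
    simp only [backSet, RunAdj, h (u + 1 - m) (by omega)]

/-- If each new vertex and each vertex of the starting graph is joined to a clique of at most `k`
earlier vertices, then `4 ^ k` colors suffice. -/
theorem onlineNonrepColorable_of_clique {G₀ : SimpleGraph (Fin m)} {R : Rule} {k c : ℕ}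
    (hc : 4 ^ k = c)
    (h₀ : ∀ i : Fin m, G₀.IsClique {j | j < i ∧ G₀.Adj j i} ∧
      {j | j < i ∧ G₀.Adj j i}.encard ≤ k)
    (hR : ∀ n G D C, R n G D C → G.IsClique D ∧ D.encard ≤ k) :
    OnlineNonrepColorable G₀ R c := by
  have e : (Fin k → Fin 4) ≃ Fin c := Fintype.equivFinOfCardEq (by simpa using hc)
  refine ⟨⟨fun G i => e ((backStrategy m k).color G i), fun G H i h =>
    congrArg e ((backStrategy m k).nonanticipating G H i h)⟩, fun N G ⟨hG₀, hG⟩ T hT => ?_⟩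
  have hG' : ∀ t < T, ∃ D C, R (m + t) (G t) D C ∧ G (t + 1) = extend (G t) D C := by
    intro t ht
    obtain ⟨D, C, -, h⟩ := hG t (le_trans (by exact_mod_cast ht) hT)
    exact ⟨D, C, h⟩
  clear hG
  -- Every edge that is ever present was present when its later end arrived.
  have hback : ∀ t ≤ T, ∀ a b, a < b → RunAdj G t a b → a ∈ backSet G b := by
    intro t
    induction t with
    | zero =>
      intro _ a b hab h
      have hb : b + 1 - m = 0 := by obtain ⟨-, hb, -⟩ := h; omega
      exact ⟨hab, by rwa [hb]⟩
    | succ t ih =>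
      intro ht a b hab h
      by_cases hb : b = m + t
      · exact ⟨hab, by rwa [show b + 1 - m = t + 1 by omega]⟩
      · obtain ⟨ha', hb', h⟩ := h
        obtain ⟨D, C, -, hext⟩ := hG' t (by omega)
        rw [hext, extend, SimpleGraph.sup_adj] at h
        refine ih (by omega) a b hab ?_
        rcases h with h | h
        · obtain ⟨x, y, hxy, hx, hy⟩ := (SimpleGraph.map_adj _ _ _ _).1 h
          have hx := congrArg Fin.val hx
          have hy := congrArg Fin.val hy
          simp only [Fin.castSuccEmb_apply, Fin.val_castSucc] at hx hy
          subst hx hy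
          exact ⟨x.2, y.2, (SimpleGraph.deleteEdges_adj.1 hxy).1⟩
        · exfalso
          rw [SimpleGraph.fromEdgeSet_adj] at h
          obtain ⟨⟨x, -, hx⟩, -⟩ := h
          have hlast : (⟨a, ha'⟩ : Fin (m + t + 1)) = Fin.last (m + t) ∨
              (⟨b, hb'⟩ : Fin (m + t + 1)) = Fin.last (m + t) := by
            have hx' : s(x.castSucc, Fin.last (m + t)) = s(⟨a, ha'⟩, ⟨b, hb'⟩) := hx
            have hmem := Sym2.mem_mk_right x.castSucc (Fin.last (m + t))
            rw [hx', Sym2.mem_iff] at hmem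
            exact hmem.imp Eq.symm Eq.symm
          rcases hlast with h | h <;> have := congrArg Fin.val h <;> simp at this <;> omega
  -- The earlier neighbours of a vertex on arrival form a small clique.
  have hclique : ∀ i < m + T, ∃ (t : ℕ) (_ : t ≤ T) (S : Set (Fin (m + t))),
      (G t).IsClique S ∧ S.encard ≤ k ∧ backSet G i = Fin.val '' S := by
    intro i hi
    by_cases him : i < m
    · refine ⟨0, by omega, {j | j < ⟨i, him⟩ ∧ (G 0).Adj j ⟨i, him⟩}, ?_, ?_, ?_⟩
      · rw [hG₀]; exact (h₀ ⟨i, him⟩).1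
      · rw [hG₀]; exact (h₀ ⟨i, him⟩).2
      · ext j
        rw [mem_backSet (show i + 1 - m = 0 by omega)]
        constructor
        · rintro ⟨hj, hj', hi', h⟩
          exact ⟨⟨j, hj'⟩, ⟨hj, h⟩, rfl⟩
        · rintro ⟨x, ⟨hx, h⟩, rfl⟩
          exact ⟨hx, x.2, him, h⟩
    · obtain ⟨t, rfl⟩ : ∃ t, i = m + t := ⟨i - m, by omega⟩
      obtain ⟨D, C, hDC, hext⟩ := hG' t (by omega)
      obtain ⟨h1, h2⟩ := hR _ _ _ _ hDC
      refine ⟨t, by omega, D, h1, h2, ?_⟩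
      ext j
      rw [mem_backSet (show m + t + 1 - m = t + 1 by omega), RunAdj]
      simp only [hext, extend, SimpleGraph.sup_adj, SimpleGraph.map_adj,
        SimpleGraph.fromEdgeSet_adj]
      constructor
      · rintro ⟨hj, hj', hi', ⟨x, y, -, -, hy⟩ | ⟨⟨x, hx, hxe⟩, -⟩⟩
        · have := congrArg Fin.val hy
          simp at this
          omega
        · refine ⟨x, hx, ?_⟩
          rcases Sym2.eq_iff.1 hxe with ⟨h, -⟩ | ⟨h, -⟩
          · simpa using congrArg Fin.val h
          · have := congrArg Fin.val h
            simp at this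
            omega
      · rintro ⟨x, hx, rfl⟩
        refine ⟨x.2, by omega, by omega, Or.inr ⟨⟨x, hx, rfl⟩, fun h => ?_⟩⟩
        have := congrArg Fin.val h
        simp at this
        omega
  -- The run may leave the rules after time `T`, so only the vertices present then are kept.
  set B : ℕ → Set ℕ := fun v => if v < m + T then backSet G v else ∅ with hBdef
  have hBpos : ∀ v < m + T, B v = backSet G v := fun v hv => if_pos hv
  have hBneg : ∀ v, ¬ v < m + T → B v = ∅ := fun v hv => if_neg hv
  have hB : IsCliqueAttached B k := by
    refine ⟨fun v u hu => ?_, fun v u hu u' hu' => ?_, fun v => ?_⟩ <;> by_cases hv : v < m + T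
    · rw [hBpos v hv] at hu
      exact hu.1
    · simp [hBneg v hv] at hu
    · rw [hBpos v hv] at hu hu'
      rw [hBpos u (hu.1.trans hv), hBpos u' (hu'.1.trans hv)]
      obtain ⟨t, ht, S, hS, -, hSv⟩ := hclique v hv
      rw [hSv] at hu hu'
      obtain ⟨x, hx, rfl⟩ := hu
      obtain ⟨y, hy, rfl⟩ := hu'
      rcases lt_trichotomy x.val y.val with h | h | h
      · exact Or.inr (Or.inl (hback t ht _ _ h
          ⟨x.2, y.2, hS hx hy fun e => h.ne (congrArg Fin.val e)⟩))
      · exact Or.inl h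
      · exact Or.inr (Or.inr (hback t ht _ _ h
          ⟨y.2, x.2, hS hy hx fun e => h.ne (congrArg Fin.val e)⟩))
    · simp [hBneg v hv] at hu
    · rw [hBpos v hv]
      obtain ⟨t, ht, S, -, hS, hSv⟩ := hclique v hv
      rw [hSv]
      exact (Set.encard_image_le _ _).trans hS
    · simp [hBneg v hv]
  rintro u v p hp ⟨x, hx, hxx⟩
  obtain ⟨s, s', hss, hsx, hsx'⟩ := List.map_eq_append_iff.1 hxx
  have hmap : p.support.map Fin.val = s.map Fin.val ++ s'.map Fin.val := by
    rw [hss, List.map_append]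
  refine hB.map_backColor_ne (s := s.map Fin.val) (s' := s'.map Fin.val) ?_ ?_ ?_ ?_
  · rintro h
    rw [List.map_eq_nil_iff] at h
    exact hx (by rw [← hsx, h, List.map_nil])
  · rw [← hmap]
    exact hp.support_nodup.map Fin.val_injective
  · rw [← hmap, List.isChain_map]
    refine p.isChain_adj_support.imp fun a b hab => ?_
    rcases lt_trichotomy a.val b.val with h | h | h
    · exact Or.inl (by rw [hBpos b b.2]; exact hback T le_rfl _ _ h ⟨a.2, b.2, hab⟩)
    · exact absurd (Fin.ext h) hab.ne
    · exact Or.inr (by rw [hBpos a a.2]; exact hback T le_rfl _ _ h ⟨b.2, a.2, hab.symm⟩)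
  · have hcol : ∀ a : Fin (m + T), backColor k B a = e.symm (e (backColor k (backSet G) a)) := by
      intro a
      rw [e.symm_apply_apply]
      exact backColor_congr hB.lt fun u hu => hBpos u (hu.trans_lt a.2)
    have := congrArg (List.map e.symm) (hsx.trans hsx'.symm)
    simpa [Function.comp_def, backStrategy, hcol] using this

end Strategy

theorem encard_pair_le {α : Type*} (x y : α) : ({x, y} : Set α).encard ≤ (2 : ℕ) := by
  refine (Set.encard_insert_le _ _).trans ?_
  rw [Set.encard_singleton]
  norm_num

theorem isClique_of_move {n : ℕ} {G : SimpleGraph (Fin n)} {D : Set (Fin n)}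
    {C : Set (Sym2 (Fin n))} (h : IsAttach D C ∨ IsSubdivide G D C ∨ IsAddEar G D C) :
    G.IsClique D ∧ D.encard ≤ (2 : ℕ) := by
  rcases h with ⟨x, rfl, -⟩ | ⟨x, y, hxy, rfl, -⟩ | ⟨x, y, hxy, rfl, -⟩
  · exact ⟨SimpleGraph.isClique_singleton x, by rw [Set.encard_singleton]; norm_num⟩
  all_goals
    exact ⟨SimpleGraph.isClique_pair.2 fun _ => hxy, encard_pair_le x y⟩

end OnlineNonrep

theorem corollary3 :
    OnlineNonrep.OnlineNonrepColorable OnlineNonrep.singleVertex OnlineNonrep.treeRule 16 ∧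
    OnlineNonrep.OnlineNonrepColorable OnlineNonrep.triangle OnlineNonrep.cycleRule 16 ∧
    OnlineNonrep.OnlineNonrepColorable OnlineNonrep.singleVertex
      OnlineNonrep.seriesParallelRule 16 := by
  have hsingle : ∀ i : Fin 1, OnlineNonrep.singleVertex.IsClique
      {j | j < i ∧ OnlineNonrep.singleVertex.Adj j i} ∧
      {j | j < i ∧ OnlineNonrep.singleVertex.Adj j i}.encard ≤ (2 : ℕ) := by
    intro i
    simp [OnlineNonrep.singleVertex]
  refine ⟨OnlineNonrep.onlineNonrepColorable_of_clique (k := 2) rfl hsingle ?_,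
    OnlineNonrep.onlineNonrepColorable_of_clique (k := 2) rfl (fun i => ⟨?_, ?_⟩) ?_,
    OnlineNonrep.onlineNonrepColorable_of_clique (k := 2) rfl hsingle ?_⟩
  · rintro n G D C ⟨-, h⟩
    exact OnlineNonrep.isClique_of_move (h.imp id Or.inl)
  · exact fun x _ y _ hxy => hxy
  · refine (Set.encard_le_encard (t := {0, 1}) fun j hj => ?_).trans (OnlineNonrep.encard_pair_le _ _)
    have h1 : j < i := hj.1
    have h2 := i.2
    simp only [Set.mem_insert_iff, Set.mem_singleton_iff, Fin.ext_iff]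
    have : j.val < i.val := h1
    simp
    omega
  · rintro n G D C ⟨-, h⟩
    exact OnlineNonrep.isClique_of_move (Or.inr (Or.inl h))
  · rintro n G D C ⟨-, h⟩
    exact OnlineNonrep.isClique_of_move h
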